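/- All graphs are finite and simple. A graph $H$ is a minor of a graph $G$ if a graph isomorphic to $H$ can be obtained from $G$ by a sequence of operations, each of which takes a subgraph or contracts an edge (suppressing loops and multiple edges). An obstruction to a family $\mathcal F$ of graphs is a minimal element, in the minor order, of the complement of $\mathcal F$: a graph $O\notin\mathcal F$ such that every minor of $O$ that is not in $\mathcal F$ has $O$ as a minor (equivalently, is isomorphic to $O$). Let $k\text{-FVS}$ be the family of graphs $G=(V,E)$ for which there is a set $S\subseteq V$ with $|S|\le k$ containing at least one vertex of every cycle of $G$. A path decomposition of $G$ is a finite sequence $T_0,\dots,T_n$ of subsets of $V$ such that every edge of $G$ has both ends in some $T_i$, and $T_i\cap T_l\subseteq T_j$ whenever $i\le j\le l$; its width is $\max_i|T_i|-1$. A graph has pathwidth at most $k$ if it has a path decomposition of width at most $k$, and $k\text{-PATHWIDTH}$ is the family of graphs of pathwidth at most $k$. Lemma. Let $O$ be an obstruction to $2\text{-FVS}$ with pathwidth greater than $4$. Then either $O$ has at least $24$ vertices, or $O$ is also an obstruction to $k\text{-PATHWIDTH}$ for some $k\ge 4$ (the "or" is inclusive). -/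

import Mathlib

universe u

namespace SimpleGraph

/-- The simple graph obtained from `G` by contracting the edge `ab`: the vertex `b` is removed, and
`a` stands for the merged vertex, adjacent to every other vertex that was adjacent to `a` or
to `b`. Loops and multiple edges are suppressed. -/
def contractEdge {V : Type u} (G : SimpleGraph V) (a b : V) : SimpleGraph {v : V // v ≠ b} where
  Adj x y := x ≠ y ∧
    (G.Adj x y ∨ ((x : V) = a ∧ G.Adj b y) ∨ ((y : V) = a ∧ G.Adj b x))
  symm := ⟨fun _ _ h => ⟨h.1.symm, h.2.elim (fun h => Or.inl h.symm) fun h => Or.inr h.symm⟩⟩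
  loopless := ⟨fun _ h => h.1 rfl⟩

/-- `G.ReducesTo H`: the graph `H` is obtained from `G` by a finite sequence of operations, each of
which takes a subgraph or contracts an edge. -/
inductive ReducesTo {V : Type u} (G : SimpleGraph V) :
    ∀ {W : Type u}, SimpleGraph W → Prop
  | refl : ReducesTo G G
  | subgraph {W : Type u} {H : SimpleGraph W} (h : ReducesTo G H) (S : H.Subgraph) :
      ReducesTo G S.coe
  | contract {W : Type u} {H : SimpleGraph W} (h : ReducesTo G H) (a b : W) (hab : H.Adj a b) :
      ReducesTo G (H.contractEdge a b)

/-- The minor order: `H` is a minor of `G` if a graph isomorphic to `H` is obtained from `G` by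
taking subgraphs and contracting edges. -/
def IsMinorOf {W V : Type u} (H : SimpleGraph W) (G : SimpleGraph V) : Prop :=
  ∃ (U : Type u) (K : SimpleGraph U), G.ReducesTo K ∧ Nonempty (H ≃g K)

/-- A finite graph `G` is an obstruction to the family `F` of finite graphs if it is a minimal
element, with respect to the minor order, of the complement of `F`. -/
def IsObstructionTo {V : Type u} (G : SimpleGraph V)
    (F : ∀ {W : Type u}, SimpleGraph W → Prop) : Prop :=
  ¬ F G ∧ ∀ (W : Type u) [Finite W] (H : SimpleGraph W),
    ¬ F H → H.IsMinorOf G → G.IsMinorOf H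

/-- `S` is a feedback vertex set of `G`: it contains a vertex of every cycle of `G`. -/
def IsFeedbackVertexSet {V : Type u} (G : SimpleGraph V) (S : Finset V) : Prop :=
  ∀ (v : V) (c : G.Walk v v), c.IsCycle → ∃ w ∈ S, w ∈ c.support

/-- The family `k`-FEEDBACK VERTEX SET: graphs with a feedback vertex set of size at most `k`. -/
def InFVS (k : ℕ) {V : Type u} (G : SimpleGraph V) : Prop :=
  ∃ S : Finset V, S.card ≤ k ∧ G.IsFeedbackVertexSet S

/-- A path decomposition of `G`: bags indexed by the vertices `0, 1, …, length` of a path. Isolated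
vertices of `G` need not lie in a bag; adding a bag of size one for each of them shows that this
makes no difference to whether there is a decomposition of width at most a given `k ≥ 0`. -/
structure PathDecomposition {V : Type u} (G : SimpleGraph V) where
  /-- The number of edges of the path. -/
  length : ℕ
  /-- The bags. -/
  bag : Fin (length + 1) → Finset V
  covering : ∀ u v : V, G.Adj u v → ∃ i, u ∈ bag i ∧ v ∈ bag i
  interpolation : ∀ i j l, i ≤ j → j ≤ l → ∀ v, v ∈ bag i → v ∈ bag l → v ∈ bag j

/-- The family `k`-PATHWIDTH: graphs of pathwidth at most `k`, that is, with a path decomposition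
of width (maximal size of a bag, minus one) at most `k`. -/
def InPathwidth (k : ℕ) {V : Type u} (G : SimpleGraph V) : Prop :=
  ∃ D : G.PathDecomposition, ∀ i, (D.bag i).card ≤ k + 1

end SimpleGraph

/-! The value k = 4 works whenever O has at most 23 vertices. Let H be a minor of O of pathwidth
above 4. If H had two vertices meeting all cycles, the rest would be a forest on at most 21
vertices; such forests have pathwidth at most 2, and putting the two vertices into every bag gives
width 4. So H is outside 2-FVS, and minimality of O for 2-FVS makes O a minor of H.

The bound for forests is `IsAcyclic.hasIntervalRep_succ`. Path decompositions are handled as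
interval representations, thickness being bag size. Call a branch at a vertex (a component left by
its removal) heavy if it has more than m vertices. Take a smallest heavy branch C, at v, attached at
c. All branches of C at c are light, so they lie side by side under one long interval for c. The
remainder has at most 2m + 2 vertices and is representable with v at its end, so the two parts can
be joined along the edge vc. -/

namespace SimpleGraph

variable {V : Type u} {G : SimpleGraph V}

/-! ### Interval representations and path decompositions -/

/-- The integer intervals `[l v, r v]`, `v ∈ A`, form a representation of a supergraph of `G[A]`
in which every point is covered at most `k` times. -/
structure IsIntervalRep (G : SimpleGraph V) (A : Finset V) (k : ℕ) (l r : V → ℤ) : Prop where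
  le : ∀ v ∈ A, l v ≤ r v
  adj : ∀ u ∈ A, ∀ v ∈ A, G.Adj u v → l u ≤ r v
  card : ∀ t, (A.filter fun v => l v ≤ t ∧ t ≤ r v).card ≤ k

/-- `G[A]` has an interval representation of thickness at most `k`. -/
def HasIntervalRep (G : SimpleGraph V) (A : Finset V) (k : ℕ) : Prop :=
  ∃ l r, G.IsIntervalRep A k l r

/-- `G[A]` has an interval representation of thickness at most `k` in which no interval starts
before that of the vertex `a` of `A`. -/
def HasRootedIntervalRep (G : SimpleGraph V) (A : Finset V) (a : V) (k : ℕ) : Prop :=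
  a ∈ A ∧ ∃ l r, G.IsIntervalRep A k l r ∧ ∀ v ∈ A, l a ≤ l v

theorem IsIntervalRep.shift {A : Finset V} {k : ℕ} {l r : V → ℤ} (h : G.IsIntervalRep A k l r)
    (c : ℤ) : G.IsIntervalRep A k (fun v => l v + c) (fun v => r v + c) where
  le v hv := by have := h.le v hv; lia
  adj u hu v hv huv := by have := h.adj u hu v hv huv; lia
  card t := by
    refine (Finset.card_le_card fun v hv => ?_).trans (h.card (t - c))
    simp only [Finset.mem_filter] at hv ⊢
    exact ⟨hv.1, by lia, by lia⟩

theorem IsIntervalRep.neg {A : Finset V} {k : ℕ} {l r : V → ℤ} (h : G.IsIntervalRep A k l r) :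
    G.IsIntervalRep A k (fun v => -r v) (fun v => -l v) where
  le v hv := by have := h.le v hv; lia
  adj u hu v hv huv := by have := h.adj v hv u hu huv.symm; lia
  card t := by
    refine (Finset.card_le_card fun v hv => ?_).trans (h.card (-t))
    simp only [Finset.mem_filter] at hv ⊢
    exact ⟨hv.1, by lia, by lia⟩

theorem exists_forall_le_int (A : Finset V) (f : V → ℤ) : ∃ M, ∀ v ∈ A, f v ≤ M := by
  obtain ⟨M, hM⟩ := (A.image f).bddAbove
  exact ⟨M, fun v hv => hM (by simpa using ⟨v, hv, rfl⟩)⟩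

theorem exists_forall_int_le (A : Finset V) (f : V → ℤ) : ∃ M, ∀ v ∈ A, M ≤ f v := by
  obtain ⟨M, hM⟩ := exists_forall_le_int A (fun v => -f v)
  exact ⟨-M, fun v hv => by have := hM v hv; lia⟩

theorem HasIntervalRep.of_card_le {A : Finset V} {k : ℕ} (h : A.card ≤ k) :
    G.HasIntervalRep A k :=
  ⟨fun _ => 0, fun _ => 0, fun _ _ => le_rfl, fun _ _ _ _ _ => le_rfl,
    fun _ => (Finset.card_filter_le _ _).trans h⟩

theorem HasIntervalRep.inPathwidth [Fintype V] {k : ℕ}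
    (h : G.HasIntervalRep Finset.univ (k + 1)) : G.InPathwidth k := by
  obtain ⟨l, r, hlr⟩ := h
  obtain ⟨M, hM⟩ := exists_forall_le_int Finset.univ l
  obtain ⟨N, hN⟩ := exists_forall_int_le Finset.univ l
  refine ⟨⟨(M - N).toNat, fun i => Finset.univ.filter fun v => l v ≤ N + i ∧ N + i ≤ r v,
    fun u v huv => ?_, fun i j k hij hjk v hi hk => ?_⟩, fun i => hlr.card _⟩
  · have hu := hM u (Finset.mem_univ _)
    have hv := hM v (Finset.mem_univ _)
    have hu' := hN u (Finset.mem_univ _)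
    have hv' := hN v (Finset.mem_univ _)
    have h1 := hlr.adj u (Finset.mem_univ _) v (Finset.mem_univ _) huv
    have h2 := hlr.adj v (Finset.mem_univ _) u (Finset.mem_univ _) huv.symm
    have h3 := hlr.le u (Finset.mem_univ _)
    have h4 := hlr.le v (Finset.mem_univ _)
    -- Intersecting intervals share the larger left end, so bags at points from `N` to `M` suffice.
    refine ⟨⟨(max (l u) (l v) - N).toNat, by lia⟩, ?_⟩
    simp only [Finset.mem_filter, Finset.mem_univ, true_and]
    lia
  · rw [Fin.le_def] at hij hjk
    simp only [Finset.mem_filter, Finset.mem_univ, true_and] at hi hk ⊢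
    lia

theorem ReducesTo.nonempty_embedding {W : Type u} {H : SimpleGraph W} (h : G.ReducesTo H) :
    Nonempty (W ↪ V) := by
  induction h with
  | refl => exact ⟨.refl _⟩
  | subgraph _ S ih => exact ih.map (Function.Embedding.subtype _).trans
  | contract _ a b _ ih => exact ih.map (Function.Embedding.subtype _).trans

theorem IsMinorOf.card_le [Finite V] {W : Type u} {H : SimpleGraph W} (h : H.IsMinorOf G) :
    Nat.card W ≤ Nat.card V := by
  obtain ⟨U, K, hK, ⟨e⟩⟩ := h
  obtain ⟨f⟩ := hK.nonempty_embedding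
  exact Finite.card_le_of_embedding (e.toEquiv.toEmbedding.trans f)

/-! ### Gluing representations -/

variable [DecidableEq V]

theorem HasIntervalRep.union {A B : Finset V} {k : ℕ} (hA : G.HasIntervalRep A k)
    (hB : G.HasIntervalRep B k) (hAB : Disjoint A B)
    (h : ∀ x ∈ A, ∀ y ∈ B, ¬ G.Adj x y) : G.HasIntervalRep (A ∪ B) k := by
  obtain ⟨l, r, hlr⟩ := hA
  obtain ⟨l₂, r₂, h₂⟩ := hB
  obtain ⟨M, hM⟩ := exists_forall_le_int A r
  obtain ⟨N, hN⟩ := exists_forall_int_le B l₂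
  have h₃ := h₂.shift (M + 1 - N)
  have hBA : ∀ v ∈ B, v ∉ A := fun v hv hv' => Finset.disjoint_left.1 hAB hv' hv
  refine ⟨fun v => if v ∈ A then l v else l₂ v + (M + 1 - N),
    fun v => if v ∈ A then r v else r₂ v + (M + 1 - N), ?_, ?_, ?_⟩
  · intro v hv
    by_cases hvA : v ∈ A
    · simpa [hvA] using hlr.le v hvA
    · simpa [hvA] using h₂.le v (by simpa [hvA] using hv)
  · intro u hu v hv huv
    rcases Finset.mem_union.1 hu with hu | hu <;> rcases Finset.mem_union.1 hv with hv | hv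
    · simpa [hu, hv] using hlr.adj u hu v hv huv
    · exact absurd huv (h u hu v hv)
    · exact absurd huv.symm (h v hv u hu)
    · simpa [hBA u hu, hBA v hv] using h₂.adj u hu v hv huv
  · intro t
    rcases le_or_gt t M with ht | ht
    · refine (Finset.card_le_card fun v hv => ?_).trans (hlr.card t)
      simp only [Finset.mem_filter, Finset.mem_union] at hv ⊢
      by_cases hvA : v ∈ A
      · simpa [hvA] using hv.2
      · have hvB := hv.1.resolve_left hvA
        have := hN v hvB
        simp only [hvA, if_false] at hv
        lia
    · refine (Finset.card_le_card fun v hv => ?_).trans (h₃.card t)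
      simp only [Finset.mem_filter, Finset.mem_union] at hv ⊢
      by_cases hvA : v ∈ A
      · have := hM v hvA
        simp only [hvA, if_true] at hv
        lia
      · have hvB := hv.1.resolve_left hvA
        simp only [hvA, if_false] at hv
        exact ⟨hvB, hv.2⟩

/-- Adding a set `S` of vertices whose intervals span the whole representation. -/
theorem HasIntervalRep.exists_union {A S : Finset V} {k : ℕ} (hA : G.HasIntervalRep A k)
    (hAS : Disjoint A S) : ∃ l r, G.IsIntervalRep (A ∪ S) (k + S.card) l r ∧
      ∀ s ∈ S, ∀ v ∈ A ∪ S, l s ≤ l v ∧ r v ≤ r s := by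
  obtain ⟨l, r, hlr⟩ := hA
  obtain ⟨M, hM⟩ := exists_forall_le_int A r
  obtain ⟨N, hN⟩ := exists_forall_int_le A l
  have hSA : ∀ v ∈ S, v ∉ A := fun v hv hv' => Finset.disjoint_left.1 hAS hv' hv
  have hl : ∀ v, min M N ≤ if v ∈ A then l v else min M N := by
    intro v
    by_cases hvA : v ∈ A
    · have := hN v hvA
      simp only [hvA, if_true]
      lia
    · simp [hvA]
  have hr : ∀ v, (if v ∈ A then r v else max M N) ≤ max M N := by
    intro v
    by_cases hvA : v ∈ A
    · have := hM v hvA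
      simp only [hvA, if_true]
      lia
    · simp [hvA]
  refine ⟨fun v => if v ∈ A then l v else min M N,
    fun v => if v ∈ A then r v else max M N, ⟨?_, ?_, ?_⟩, ?_⟩
  · intro v _
    by_cases hvA : v ∈ A
    · simpa [hvA] using hlr.le v hvA
    · simp only [hvA, if_false]
      lia
  · intro u _ v _ huv
    by_cases huA : u ∈ A
    · by_cases hvA : v ∈ A
      · simpa [huA, hvA] using hlr.adj u huA v hvA huv
      · have := hM u huA
        have := hlr.le u huA
        simp only [huA, hvA, if_true, if_false]
        lia
    · by_cases hvA : v ∈ A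
      · have := hN v hvA
        have := hlr.le v hvA
        simp only [huA, hvA, if_true, if_false]
        lia
      · simp only [huA, hvA, if_false]
        lia
  · intro t
    refine (Finset.card_le_card
      (t := (A.filter fun v => l v ≤ t ∧ t ≤ r v) ∪ S) fun v hv => ?_).trans
      ((Finset.card_union_le _ _).trans (Nat.add_le_add_right (hlr.card t) _))
    simp only [Finset.mem_filter, Finset.mem_union] at hv ⊢
    by_cases hvA : v ∈ A
    · simp only [hvA, if_true] at hv
      exact Or.inl ⟨hvA, hv.2⟩
    · exact Or.inr (hv.1.resolve_left hvA)
  · intro s hs v _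
    simp only [hSA s hs, if_false]
    exact ⟨hl v, hr v⟩

/-- Two representations can be placed one after the other if the only edge between them joins the
vertex reaching furthest right in the first to the vertex reaching furthest left in the second. -/
theorem IsIntervalRep.exists_join {A B : Finset V} {a b : V} {k : ℕ} {l r : V → ℤ}
    (hA : G.IsIntervalRep A k l r) (ha : a ∈ A) (hmax : ∀ v ∈ A, r v ≤ r a)
    (hB : G.HasRootedIntervalRep B b k) (hk : 2 ≤ k) (hAB : Disjoint A B)
    (h : ∀ x ∈ A, ∀ y ∈ B, G.Adj x y → x = a ∧ y = b) :
    ∃ l' r', G.IsIntervalRep (A ∪ B) k l' r' ∧ (∀ v ∈ A, l' v = l v) ∧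
      ∀ u ∈ A, ∀ v ∈ B, l' u ≤ l' v := by
  obtain ⟨hb, l₂, r₂, h₂, hmin⟩ := hB
  have hBA : ∀ v ∈ B, v ∉ A := fun v hv hv' => Finset.disjoint_left.1 hAB hv' hv
  -- This shift leaves the point `r a + 1` free. Both `a` and `b` are stretched to it and nothing
  -- else covers it, hence `2 ≤ k`.
  set c : ℤ := r a + 2 - l₂ b with hc
  have h₃ := h₂.shift c
  have hll : ∀ v ∈ A, (if v ∈ A then l v else if v = b then r a + 1 else l₂ v + c) = l v :=
    fun v hv => by simp [hv]
  have hlB : ∀ v ∈ B, r a + 1 ≤ (if v ∈ A then l v else if v = b then r a + 1 else l₂ v + c) ∧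
      (if v ∈ A then l v else if v = b then r a + 1 else l₂ v + c) ≤ l₂ v + c := by
    intro v hv
    have := hmin v hv
    by_cases hvb : v = b
    · subst hvb
      simp only [hBA v hv, if_false, if_true]
      lia
    · simp only [hBA v hv, hvb, if_false]
      lia
  have hrB : ∀ v ∈ B, (if v = a then r a + 1 else if v ∈ A then r v else r₂ v + c) = r₂ v + c :=
    fun v hv => by simp [hBA v hv, show v ≠ a from fun e => hBA v hv (e ▸ ha)]
  have hrA : ∀ v ∈ A, r v ≤ (if v = a then r a + 1 else if v ∈ A then r v else r₂ v + c) := by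
    intro v hv
    by_cases hva : v = a
    · subst hva; simp
    · simp [hva, hv]
  refine ⟨fun v => if v ∈ A then l v else if v = b then r a + 1 else l₂ v + c,
    fun v => if v = a then r a + 1 else if v ∈ A then r v else r₂ v + c,
    ⟨?_, ?_, ?_⟩, hll, ?_⟩
  · intro v hv
    rcases Finset.mem_union.1 hv with hv | hv
    · have := hrA v hv
      have := hA.le v hv
      simp only [hll v hv]
      lia
    · have := hlB v hv
      have := h₂.le v hv
      simp only [hrB v hv]
      lia
  · intro u hu v hv huv
    rcases Finset.mem_union.1 hu with hu | hu <;> rcases Finset.mem_union.1 hv with hv | hv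
    · have := hrA v hv
      have := hA.adj u hu v hv huv
      simp only [hll u hu]
      lia
    · have := hmax u hu
      have := hA.le u hu
      have := hlB v hv
      have := h₂.le v hv
      simp only [hll u hu, hrB v hv]
      lia
    · obtain ⟨rfl, rfl⟩ := h v hv u hu huv.symm
      simp [hBA u hu]
    · have := hlB u hu
      have := h₂.adj u hu v hv huv
      simp only [hrB v hv]
      lia
  · intro t
    rcases lt_trichotomy t (r a + 1) with ht | ht | ht
    · refine (Finset.card_le_card fun v hv => ?_).trans (hA.card t)
      simp only [Finset.mem_filter, Finset.mem_union] at hv ⊢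
      rcases hv with ⟨hv | hv, h1, h2⟩
      · rw [hll v hv] at h1
        refine ⟨hv, h1, ?_⟩
        by_cases hva : v = a
        · subst hva; lia
        · simpa [hva, hv] using h2
      · have := hlB v hv
        lia
    · refine (Finset.card_le_card (t := {a, b}) fun v hv => ?_).trans (Finset.card_le_two.trans hk)
      simp only [Finset.mem_filter, Finset.mem_union, Finset.mem_insert,
        Finset.mem_singleton] at hv ⊢
      rcases hv with ⟨hv | hv, h1, h2⟩
      · by_contra hne
        push Not at hne
        simp only [hne.1, hv, if_true, if_false] at h2
        have := hmax v hv
        lia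
      · by_contra hne
        push Not at hne
        simp only [hne.2, hBA v hv, if_false] at h1
        have := hmin v hv
        lia
    · refine (Finset.card_le_card fun v hv => ?_).trans (h₃.card t)
      simp only [Finset.mem_filter, Finset.mem_union] at hv ⊢
      rcases hv with ⟨hv | hv, h1, h2⟩
      · by_cases hva : v = a
        · simp only [hva, if_true] at h2
          lia
        · simp only [hva, hv, if_true, if_false] at h2
          have := hmax v hv
          lia
      · rw [hrB v hv] at h2
        refine ⟨hv, ?_, h2⟩
        by_cases hvb : v = b
        · subst hvb; lia
        · simpa [hvb, hBA v hv] using h1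
  · intro u hu v hv
    have := hlB v hv
    have := hmax u hu
    have := hA.le u hu
    simp only [hll u hu]
    lia

theorem HasRootedIntervalRep.join {A B : Finset V} {a b : V} {k : ℕ}
    (hA : G.HasRootedIntervalRep A a k) (hB : G.HasRootedIntervalRep B b k) (hk : 2 ≤ k)
    (hAB : Disjoint A B) (h : ∀ x ∈ A, ∀ y ∈ B, G.Adj x y → x = a ∧ y = b) :
    G.HasIntervalRep (A ∪ B) k := by
  obtain ⟨ha, l, r, hlr, hmin⟩ := hA
  -- Reflection turns the leftmost root `a` into the rightmost.
  obtain ⟨l', r', h', -⟩ :=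
    hlr.neg.exists_join ha (fun v hv => neg_le_neg (hmin v hv)) hB hk hAB h
  exact ⟨l', r', h'⟩

theorem HasIntervalRep.insert_rooted {A : Finset V} {a : V} {k : ℕ} (hA : G.HasIntervalRep A k)
    (ha : a ∉ A) : G.HasRootedIntervalRep (insert a A) a (k + 1) := by
  obtain ⟨l, r, h, hs⟩ := hA.exists_union (S := {a}) (by simpa using ha)
  rw [Finset.card_singleton, Finset.union_comm, ← Finset.insert_eq] at h
  refine ⟨by simp, l, r, h, fun v hv => (hs a (by simp) v ?_).1⟩
  rwa [Finset.union_comm, ← Finset.insert_eq]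

theorem HasRootedIntervalRep.extend {A B : Finset V} {a b : V} {k : ℕ}
    (hA : G.HasIntervalRep A k) (ha : a ∉ A) (hB : G.HasRootedIntervalRep B b (k + 1))
    (hk : 1 ≤ k) (hAB : Disjoint (insert a A) B)
    (h : ∀ x ∈ insert a A, ∀ y ∈ B, G.Adj x y → x = a ∧ y = b) :
    G.HasRootedIntervalRep (insert a A ∪ B) a (k + 1) := by
  obtain ⟨l, r, hlr, hs⟩ := hA.exists_union (S := {a}) (by simpa using ha)
  rw [Finset.union_comm, ← Finset.insert_eq] at hs
  rw [Finset.card_singleton, Finset.union_comm, ← Finset.insert_eq] at hlr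
  obtain ⟨l', r', h', hl, hle⟩ := hlr.exists_join (Finset.mem_insert_self a A)
    (fun v hv => (hs a (by simp) v hv).2) hB (by lia) hAB h
  refine ⟨by simp, l', r', h', fun v hv => ?_⟩
  rcases Finset.mem_union.1 hv with hv | hv
  · rw [hl v hv, hl a (by simp)]
    exact (hs a (by simp) v hv).1
  · exact hle a (by simp) v hv

/-! ### Connected sets and branches of a forest -/

/-- `G[C]` is connected or empty: every nontrivial cut of `C` is crossed by an edge. -/
def IsCutConnected (G : SimpleGraph V) (C : Finset V) : Prop :=
  ∀ X ⊆ C, X.Nonempty → X ≠ C → ∃ x ∈ X, ∃ y ∈ C \ X, G.Adj x y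

theorem IsCutConnected.insert {C : Finset V} (hC : G.IsCutConnected C) {x y : V} (hx : x ∈ C)
    (hxy : G.Adj x y) : G.IsCutConnected (insert y C) := by
  intro X hX hne hXC
  by_cases h1 : (X ∩ C).Nonempty
  · by_cases h2 : X ∩ C = C
    · have hyX : y ∉ X := fun hy => hXC (hX.antisymm (Finset.insert_subset hy
        (h2 ▸ Finset.inter_subset_left)))
      exact ⟨x, Finset.inter_subset_left (h2.symm ▸ hx), y, by simp [hyX], hxy⟩
    · obtain ⟨u, hu, v, hv, huv⟩ := hC _ Finset.inter_subset_right h1 h2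
      simp only [Finset.mem_inter, Finset.mem_sdiff, not_and'] at hu hv
      exact ⟨u, hu.1, v, by simp [hv.1, hv.2 hv.1], huv⟩
  · have hd : ∀ z ∈ X, z ∉ C := fun z hz hz' => h1 ⟨z, by simp [hz, hz']⟩
    obtain ⟨z, hz⟩ := hne
    obtain rfl : z = y := (Finset.mem_insert.1 (hX hz)).resolve_right (hd z hz)
    exact ⟨z, hz, x, by simp [hx, show x ∉ X from fun h => hd x h hx], hxy.symm⟩

/-- Along an uncrossed cut, the representations of the two sides can be placed side by side. -/
theorem HasIntervalRep.of_isCutConnected {k : ℕ} (A : Finset V)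
    (h : ∀ B ⊆ A, G.IsCutConnected B → G.HasIntervalRep B k) : G.HasIntervalRep A k := by
  induction A using Finset.strongInduction with
  | H A ih =>
    by_cases hA : G.IsCutConnected A
    · exact h A subset_rfl hA
    · simp only [IsCutConnected, not_forall, not_exists, not_and] at hA
      obtain ⟨X, hXA, hne, hX, hcut⟩ := hA
      rw [← Finset.union_sdiff_of_subset hXA]
      refine (ih X (hXA.ssubset_of_ne hX) fun B hB => h B (hB.trans hXA)).union
        (ih (A \ X) ?_ fun B hB => h B (hB.trans Finset.sdiff_subset))
        Finset.disjoint_sdiff hcut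
      exact Finset.sdiff_ssubset hXA hne

/-- A largest connected subset of `A` absorbs its neighbours in `A`; this `D` serves as a heavy
component. -/
theorem exists_isCutConnected_closed {A C : Finset V} (hCA : C ⊆ A) (hC : G.IsCutConnected C)
    {m : ℕ} (hm : m < C.card) : ∃ D ⊆ A, G.IsCutConnected D ∧ m < D.card ∧
      ∀ x ∈ D, ∀ y ∈ A, G.Adj x y → y ∈ D := by
  classical
  obtain ⟨D, hD, hmax⟩ := Finset.exists_max_image
    (A.powerset.filter fun D => G.IsCutConnected D) Finset.card ⟨C, by simp [hCA, hC]⟩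
  simp only [Finset.mem_filter, Finset.mem_powerset, and_imp] at hD hmax
  refine ⟨D, hD.1, hD.2, hm.trans_le (hmax C hCA hC), fun x hx y hy hxy => ?_⟩
  by_contra hyD
  have := hmax _ (Finset.insert_subset hy hD.1) (hD.2.insert hx hxy)
  rw [Finset.card_insert_of_notMem hyD] at this
  lia

theorem IsCutConnected.reachable {C : Finset V} (hC : G.IsCutConnected C) {v c x y : V}
    (hv : v ∉ C) (hx : x ∈ C) (hy : y ∈ C) : (G \ fromEdgeSet {s(v, c)}).Reachable x y := by
  classical
  by_contra hxy
  obtain ⟨u, hu, w, hw, huw⟩ := hC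
    (C.filter fun z => (G \ fromEdgeSet {s(v, c)}).Reachable x z) (Finset.filter_subset _ _)
    ⟨x, by simp [hx]⟩ fun h => by
      rw [← h] at hy
      exact hxy (Finset.mem_filter.1 hy).2
  simp only [Finset.mem_sdiff, Finset.mem_filter, not_and] at hu hw
  refine hw.2 hw.1 (hu.2.trans (Adj.reachable ?_))
  have h1 : v ≠ u := fun e => hv (e ▸ hu.1)
  have h2 : v ≠ w := fun e => hv (e ▸ hw.1)
  simp [huw, h1.symm, h2.symm]

/-- A second neighbour of `v` in `C` would give a detour around the bridge `vx`. -/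
theorem IsAcyclic.eq_of_adj_isCutConnected (hG : G.IsAcyclic) {C : Finset V}
    (hC : G.IsCutConnected C) {v x y : V} (hv : v ∉ C) (hx : x ∈ C) (hy : y ∈ C)
    (hvx : G.Adj v x) (hvy : G.Adj v y) : y = x := by
  by_contra hne
  have hb := isAcyclic_iff_forall_adj_isBridge.1 hG hvx
  rw [isBridge_iff] at hb
  refine hb ((Adj.reachable ?_).trans (hC.reachable hv hy hx))
  have h1 : v ≠ x := fun e => hv (e ▸ hx)
  simp [hvy, hne, h1]

theorem IsAcyclic.exists_attachment (hG : G.IsAcyclic) {C : Finset V}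
    (hC : G.IsCutConnected C) (hne : C.Nonempty) {v : V} (hv : v ∉ C) :
    ∃ c ∈ C, ∀ y ∈ C, G.Adj v y → y = c := by
  by_cases h : ∃ x ∈ C, G.Adj v x
  · obtain ⟨x, hx, hvx⟩ := h
    exact ⟨x, hx, fun y hy hvy => hG.eq_of_adj_isCutConnected hC hv hx hy hvx hvy⟩
  -- Without an edge from `v` to `C`, any vertex serves as attachment.
  · obtain ⟨x, hx⟩ := hne
    exact ⟨x, hx, fun y hy hvy => absurd ⟨y, hy, hvy⟩ h⟩

/-! ### Thickness of small forests -/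

/-- If `a` has a heavy branch `C`, at most `2m + 2 - 1 - (m + 1) = m` other vertices remain. The
interval of `a` spans these, and `C`, rooted at its attachment by induction, follows on the right.
-/
theorem IsAcyclic.hasRootedIntervalRep (hG : G.IsAcyclic) {m k : ℕ} (hk : 1 ≤ k)
    (hm : ∀ B : Finset V, B.card ≤ m → G.HasIntervalRep B k) (A : Finset V) :
    ∀ a ∈ A, A.card ≤ 2 * m + 2 → G.HasRootedIntervalRep A a (k + 1) := by
  induction A using Finset.strongInduction with
  | H A ih =>
    intro a ha hcard
    have hea := Finset.card_erase_of_mem ha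
    by_cases h : ∃ C ⊆ A.erase a, G.IsCutConnected C ∧ m < C.card
    · obtain ⟨C₀, hC₀, hconn₀, hcard₀⟩ := h
      obtain ⟨C, hCA, hC, hmC, hclosed⟩ := exists_isCutConnected_closed hC₀ hconn₀ hcard₀
      have haC : a ∉ C := fun h => Finset.notMem_erase a A (hCA h)
      obtain ⟨c, hc, huniq⟩ := hG.exists_attachment hC (Finset.card_pos.1 (by lia)) haC
      have hL : G.HasIntervalRep (A.erase a \ C) k := hm _ (by
        rw [Finset.card_sdiff_of_subset hCA]; lia)
      have hCss : C ⊂ A := (hCA.trans (Finset.erase_subset _ _)).ssubset_of_ne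
        fun e => haC (e ▸ ha)
      have hCr := ih C hCss c hc ((Finset.card_le_card hCss.1).trans hcard)
      have key := HasRootedIntervalRep.extend (a := a) hL (by simp) hCr hk ?_ ?_
      · convert key using 1
        ext v
        have := @hCA v
        simp only [Finset.mem_union, Finset.mem_insert, Finset.mem_sdiff, Finset.mem_erase] at *
        grind
      · rw [Finset.disjoint_insert_left]
        exact ⟨haC, Finset.sdiff_disjoint⟩
      · intro x hx y hy hxy
        rcases Finset.mem_insert.1 hx with rfl | hx
        · exact ⟨rfl, huniq y hy hxy⟩
        · rw [Finset.mem_sdiff] at hx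
          exact absurd (hclosed y hy x hx.1 hxy.symm) hx.2
    · push Not at h
      have := (HasIntervalRep.of_isCutConnected (A.erase a)
        fun B hB hconn => hm B (h B hB hconn)).insert_rooted (Finset.notMem_erase a A)
      rwa [Finset.insert_erase ha] at this

/-- If induced subforests on at most `m` vertices have interval representations of thickness `k`,
then those on at most `3 * m + 3` vertices have representations of thickness `k + 1`. -/
theorem IsAcyclic.hasIntervalRep_succ (hG : G.IsAcyclic) {m k : ℕ} (hk : 1 ≤ k)
    (hm : ∀ B : Finset V, B.card ≤ m → G.HasIntervalRep B k) (A : Finset V)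
    (hA : A.card ≤ 3 * m + 3) : G.HasIntervalRep A (k + 1) := by
  classical
  rcases A.eq_empty_or_nonempty with rfl | ⟨v₀, hv₀⟩
  · exact HasIntervalRep.of_card_le (by simp)
  -- The size `n` is exposed so that `Nat.find` selects a smallest heavy branch over all `v`.
  by_cases h : ∃ n, ∃ v ∈ A, ∃ C ⊆ A.erase v, G.IsCutConnected C ∧ m < C.card ∧
      (∀ x ∈ C, ∀ y ∈ A.erase v, G.Adj x y → y ∈ C) ∧ C.card = n
  · obtain ⟨v, hv, C, hCA, hC, hmC, hclosed, hn⟩ := Nat.find_spec h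
    have hmin := fun n => Nat.find_min (H := h) (m := n)
    rw [← hn] at hmin
    have hCA' : C ⊆ A := hCA.trans (Finset.erase_subset _ _)
    have hvC : v ∉ C := fun h => Finset.notMem_erase v A (hCA h)
    obtain ⟨c, hc, huniq⟩ := hG.exists_attachment hC (Finset.card_pos.1 (by lia)) hvC
    -- A heavy component of `C - c` has no edge to `v`, so it would be a smaller heavy branch at `c`
    -- in `A`.
    have hlight : ∀ B ⊆ C.erase c, G.IsCutConnected B → B.card ≤ m := by
      intro B hB hconn
      by_contra! hcard
      obtain ⟨D, hDC, hD, hmD, hDclosed⟩ := exists_isCutConnected_closed hB hconn hcard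
      refine hmin D.card ?_ ⟨c, hCA' hc, D, hDC.trans (Finset.erase_subset_erase c hCA'), hD, hmD,
        fun x hx y hy hxy => ?_, rfl⟩
      · have := Finset.card_le_card hDC
        have := Finset.card_erase_lt_of_mem hc
        lia
      · have hxC := Finset.mem_erase.1 (hDC hx)
        rw [Finset.mem_erase] at hy
        by_cases hyv : y = v
        · exact absurd (huniq x hxC.2 (hyv ▸ hxy.symm)) hxC.1
        · exact hDclosed x hx y (Finset.mem_erase.2
            ⟨hy.1, hclosed x hxC.2 y (Finset.mem_erase.2 ⟨hyv, hy.2⟩) hxy⟩) hxy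
    have hCr := (HasIntervalRep.of_isCutConnected (C.erase c)
      fun B hB hconn => hm B (hlight B hB hconn)).insert_rooted (Finset.notMem_erase c C)
    rw [Finset.insert_erase hc] at hCr
    have hvr := hG.hasRootedIntervalRep hk hm (A \ C) v (by simp [hv, hvC]) (by
      rw [Finset.card_sdiff_of_subset hCA']; lia)
    have := hvr.join hCr (by lia) Finset.sdiff_disjoint fun x hx y hy hxy => by
      rw [Finset.mem_sdiff] at hx
      obtain rfl : x = v := by
        by_contra hne
        exact hx.2 (hclosed y hy x (Finset.mem_erase.2 ⟨hne, hx.1⟩) hxy.symm)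
      exact ⟨rfl, huniq y hy hxy⟩
    rwa [Finset.sdiff_union_of_subset hCA'] at this
  -- With no heavy branch anywhere, any vertex can span the rest.
  · obtain ⟨-, l, r, hlr, -⟩ := (HasIntervalRep.of_isCutConnected (A.erase v₀)
      fun B hB hconn => hm B (by
        by_contra! hcard
        obtain ⟨D, hDA, hD, hmD, hDclosed⟩ := exists_isCutConnected_closed hB hconn hcard
        exact h ⟨_, v₀, hv₀, D, hDA, hD, hmD, hDclosed, rfl⟩)).insert_rooted
          (Finset.notMem_erase v₀ A)
    rw [Finset.insert_erase hv₀] at hlr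
    exact ⟨l, r, hlr⟩

theorem IsAcyclic.hasIntervalRep_three (hG : G.IsAcyclic) (A : Finset V) (hA : A.card ≤ 21) :
    G.HasIntervalRep A 3 :=
  -- The vertex bounds are 1, then 3·1 + 3 = 6, then 3·6 + 3 = 21.
  hG.hasIntervalRep_succ (m := 6) (k := 2) (by lia)
    (hG.hasIntervalRep_succ (m := 1) (k := 1) le_rfl fun _ => HasIntervalRep.of_card_le) A hA

/-! ### From feedback vertex sets to pathwidth -/

theorem IsFeedbackVertexSet.isAcyclic {S : Finset V} (hS : G.IsFeedbackVertexSet S) :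
    (G.induce {v | v ∉ S}).spanningCoe.IsAcyclic := by
  intro v c hc
  have hle : (G.induce {v | v ∉ S}).spanningCoe ≤ G := spanningCoe_induce_le G _
  obtain ⟨w, hw, hwc⟩ := hS v (c.mapLe hle) (hc.mapLe hle)
  rw [Walk.support_mapLe_eq_support] at hwc
  -- Started at `w ∈ S`, the cycle would have a first edge at a vertex that is isolated here.
  have hc' := hc.rotate hwc
  generalize c.rotate w hwc = d at hc'
  cases d with
  | nil => exact hc'.ne_nil rfl
  | cons h p =>
    have hwS := h
    simp only [map_adj, comap_adj, Function.Embedding.subtype_apply, Subtype.exists,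
      Set.mem_ofPred_eq] at hwS
    obtain ⟨x, hx, -, -, -, rfl, -⟩ := hwS
    exact hx hw

theorem InFVS.inPathwidth_four [Fintype V] (hG : G.InFVS 2) (hV : Fintype.card V ≤ 23) :
    G.InPathwidth 4 := by
  obtain ⟨S, hS, hfvs⟩ := hG
  -- `S` is padded to two vertices when possible, so that at most 21 remain.
  obtain ⟨T, hST, hT2, hT⟩ : ∃ T, S ⊆ T ∧ T.card ≤ 2 ∧ Fintype.card V - T.card ≤ 21 := by
    rcases le_total (Fintype.card V) 2 with h | h
    · exact ⟨S, subset_rfl, hS, by lia⟩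
    · obtain ⟨T, hT, hc⟩ := Finset.exists_superset_card_eq hS h
      exact ⟨T, hT, hc.le, by lia⟩
  have hfvsT : G.IsFeedbackVertexSet T := fun v c hc =>
    (hfvs v c hc).imp fun w hw => ⟨hST hw.1, hw.2⟩
  obtain ⟨l, r, hlr⟩ := hfvsT.isAcyclic.hasIntervalRep_three Tᶜ (by
    rwa [Finset.card_compl])
  have hrep : G.HasIntervalRep Tᶜ 3 := ⟨l, r, hlr.le, fun u hu v hv huv =>
    hlr.adj u hu v hv (by
      rw [Finset.mem_compl] at hu hv
      simp [huv, hu, hv]), hlr.card⟩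
  obtain ⟨l, r, h, -⟩ := hrep.exists_union disjoint_compl_left
  refine HasIntervalRep.inPathwidth ⟨l, r, ?_⟩
  rw [Finset.union_comm, Finset.union_compl] at h
  exact ⟨h.le, h.adj, fun t => (h.card t).trans (by lia)⟩

end SimpleGraph

theorem lemma19 {V : Type u} [Finite V] (O : SimpleGraph V)
    (hO : O.IsObstructionTo (SimpleGraph.InFVS 2))
    (hpw : ¬ SimpleGraph.InPathwidth 4 O) :
    24 ≤ Nat.card V ∨ ∃ k : ℕ, 4 ≤ k ∧ O.IsObstructionTo (SimpleGraph.InPathwidth k) := by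
  classical
  refine or_iff_not_imp_left.2 fun hcard => ⟨4, le_rfl, hpw, fun W _ H hH hHO => ?_⟩
  refine hO.2 W H (fun hfvs => hH ?_) hHO
  have := Fintype.ofFinite W
  have hW := hHO.card_le
  rw [Nat.card_eq_fintype_card (α := W)] at hW
  exact hfvs.inPathwidth_four (by lia)
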